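/- Let $m\ge 2$, let $X\subseteq\mathbb R^m$ be open and bounded, and let $Y=(0,\bar y)$ with $\bar y>0$. Let $c\in C^2(\bar X\times\bar Y)$ satisfy the twist condition ($y\mapsto D_xc(x,y)$ is injective on $Y$ for each $x\in X$) and the non-degeneracy condition ($D^2_{xy}c(x,y)\neq0$ for all $(x,y)\in\bar X\times\bar Y$). Let $\mu$ be a probability measure on $X$ that is absolutely continuous with respect to Lebesgue measure. Let $f:[0,\infty)\to\mathbb R$ be strictly convex, continuously differentiable on $(0,\infty)$, with $f(t)/t\to+\infty$ as $t\to\infty$ and $f'(t)\to-\infty$ as $t\to0^+$; then $f':(0,\infty)\to\mathbb R$ is a bijection with inverse $(f')^{-1}$. Let $\nu$ minimize $$\nu\mapsto \mathcal T_c(\mu,\nu)+\int_Y f(\bar\nu(y))\,dy$$ over all probability measures on $\bar Y$, where $\mathcal T_c(\mu,\nu)=\inf_{\gamma}\int c\,d\gamma$ is the infimum over couplings $\gamma$ of $\mu$ and $\nu$, $\bar\nu$ is the Lebesgue density of $\nu$, and the second term is $+\infty$ if $\nu$ is not absolutely continuous. For $y\in Y$ and $k\in\mathbb R$ put $X_\ge(y,k)=\{x\in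 X:\partial_yc(x,y)\ge k\}$ and $X_>(y,k)=\{x\in X:\partial_yc(x,y)>k\}$. For $y_0<y_1$ in $Y$ and $k_0\in\mathbb R$ put $k_{max}(y_0,y_1,k_0)=\sup\{k: X_\ge(y_0,k_0)\subseteq X_\ge(y_1,k)\}$ and $$D^{min}_\mu(y_0,y_1,k_0)=\mu\big(X_\ge(y_1,k_{max}(y_0,y_1,k_0))\setminus X_\ge(y_0,k_0)\big).$$ Let $M_c=\sup\{|c(x,y_0)-c(x,y_1)|/|y_0-y_1| : x\in\bar X,\ y_0\ne y_1\in\bar Y\}$, and for a bounded measurable $v:Y\to\mathbb R$ let $K_v:(0,\infty)\to\mathbb R$ be the inverse of $z\mapsto\int_Y(f')^{-1}(z-v(y))\,dy$. Then there is a function $k:Y\to\mathbb R$ with $$\mu\big(X_\ge(y,k(y))\big)=\nu((-\infty,y])\qquad\text{for all } y\in Y,$$ and for every such $k$ the following holds: if for every $y_0\in Y$ $$\sup_{y_1\in Y,\ y_1>y_0,\ y_0\le y\le y_1}\left[\frac{D^{min}_\mu(y_0,y_1,k(y_0))}{y_1-y_0}-(f')^{-1}\big(K_{-M_cy}(1)-M_cy\big)\right]<0,$$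 where $K_{-M_cy}$ is $K_v$ for the function $v(y)=-M_cy$, then $(c,\mu,\nu)$ is nested: for all $y_0<y_1$ in $Y$ with $\nu([y_0,y_1])>0$, $$X_\ge(y_0,k(y_0))\subseteq X_>(y_1,k(y_1)).$$ -/

import Mathlib

open MeasureTheory Filter Topology

noncomputable section

namespace Congestion

/-- The Euclidean space `ℝᵐ`. -/
abbrev E (m : ℕ) : Type := EuclideanSpace ℝ (Fin m)

/-! ### The cost -/

/-- `g ∈ C²(closure Ω)` for an open set `Ω`: `g` is `C²` in `Ω`, continuous on the closure, and all
its derivatives of order at most two extend continuously from `Ω` to the closure. -/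
structure IsC2OnClosure {F : Type*} [NormedAddCommGroup F] [NormedSpace ℝ F]
    (Ω : Set F) (g : F → ℝ) : Prop where
  contDiffOn : ContDiffOn ℝ 2 g Ω
  continuousOn : ContinuousOn g (closure Ω)
  extend : ∀ i : ℕ, i ≤ 2 →
    ∃ G, ContinuousOn G (closure Ω) ∧ Set.EqOn G (iteratedFDeriv ℝ i g) Ω

variable {m : ℕ}

/-- Twist condition: for each `x ∈ X` the map `y ↦ D_x c(x, y)` is injective on `Y`. -/
def Twist (X : Set (E m)) (Y : Set ℝ) (c : E m → ℝ → ℝ) : Prop :=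
  ∀ x ∈ X, Set.InjOn (fun y => fderiv ℝ (fun x' => c x' y) x) Y

/-- `∂c/∂y (x, y)`. -/
def dy (c : E m → ℝ → ℝ) (x : E m) (y : ℝ) : ℝ := deriv (c x) y

/-- The mixed derivative `D²_{xy} c (x, y)`, a linear form on `ℝᵐ`. -/
def mixed (c : E m → ℝ → ℝ) (p : E m × ℝ) : E m →L[ℝ] ℝ :=
  fderiv ℝ (fun x' => dy c x' p.2) p.1

/-- Non-degeneracy: `D²_{xy} c`, extended by continuity to `closure X × closure Y`, has full rank
there; as the target is one-dimensional, full rank means nonzero. -/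
def Nondegenerate (X : Set (E m)) (Y : Set ℝ) (c : E m → ℝ → ℝ) : Prop :=
  ∀ p ∈ closure X ×ˢ closure Y, extendFrom (X ×ˢ Y) (mixed c) p ≠ 0

/-- `M_c`, the best global Lipschitz constant of `y ↦ c(x, y)` on `closure Y`, over all
`x ∈ closure X`. The pairs `y₀ = y₁` contribute the harmless value `0 / 0 = 0`. -/
def lipConst (X : Set (E m)) (Y : Set ℝ) (c : E m → ℝ → ℝ) : ℝ :=
  sSup {r | ∃ x ∈ closure X, ∃ y₀ ∈ closure Y, ∃ y₁ ∈ closure Y,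
    r = |c x y₀ - c x y₁| / |y₀ - y₁|}

/-! ### Level sets, the splitting function, nestedness -/

/-- The super-level set `X_≥(y, k)`. -/
def superGE (X : Set (E m)) (c : E m → ℝ → ℝ) (y k : ℝ) : Set (E m) :=
  {x ∈ X | k ≤ dy c x y}

/-- The strict super-level set `X_>(y, k)`. -/
def superGT (X : Set (E m)) (c : E m → ℝ → ℝ) (y k : ℝ) : Set (E m) :=
  {x ∈ X | k < dy c x y}

/-- `k` splits the mass proportionately: `μ(X_≥(y, k(y))) = ν((-∞, y])` for all `y ∈ Y`. -/
def IsSplitting (X : Set (E m)) (Y : Set ℝ) (c : E m → ℝ → ℝ) (μ : Measure (E m))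
    (ν : Measure ℝ) (k : ℝ → ℝ) : Prop :=
  ∀ y ∈ Y, μ (superGE X c y (k y)) = ν (Set.Iic y)

/-- Nestedness of the model whose mass-splitting function is `k`. -/
def IsNested (X : Set (E m)) (Y : Set ℝ) (c : E m → ℝ → ℝ) (ν : Measure ℝ) (k : ℝ → ℝ) : Prop :=
  ∀ y₀ ∈ Y, ∀ y₁ ∈ Y, y₀ < y₁ → 0 < ν (Set.Icc y₀ y₁) →
    superGE X c y₀ (k y₀) ⊆ superGT X c y₁ (k y₁)

/-- `k_max(y₀, y₁, k₀)`. The set is nonempty and bounded above whenever `∂c/∂y` is bounded and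
`X_≥(y₀, k₀)` is nonempty. -/
def kMax (X : Set (E m)) (c : E m → ℝ → ℝ) (y₀ y₁ k₀ : ℝ) : ℝ :=
  sSup {k | superGE X c y₀ k₀ ⊆ superGE X c y₁ k}

/-- The minimal mass difference `D^min_μ(y₀, y₁, k₀)`. -/
def minMassDiff (X : Set (E m)) (c : E m → ℝ → ℝ) (μ : Measure (E m)) (y₀ y₁ k₀ : ℝ) : ℝ :=
  μ.real (superGE X c y₁ (kMax X c y₀ y₁ k₀) \ superGE X c y₀ k₀)

/-! ### The variational problem -/

/-- Transport plans between `μ` and `ν`. -/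
def plans (μ : Measure (E m)) (ν : Measure ℝ) : Set (Measure (E m × ℝ)) :=
  {γ | γ.map Prod.fst = μ ∧ γ.map Prod.snd = ν}

/-- The optimal transport cost `T_c(μ, ν)`. -/
def transportCost (c : E m → ℝ → ℝ) (μ : Measure (E m)) (ν : Measure ℝ) : ℝ :=
  sInf ((fun γ : Measure (E m × ℝ) => ∫ p, c p.1 p.2 ∂γ) '' plans μ ν)

/-- The density of `ν` with respect to Lebesgue measure. -/
def density (ν : Measure ℝ) (y : ℝ) : ℝ := (ν.rnDeriv volume y).toReal

/-- Assumptions on the congestion function `f : [0, ∞) → ℝ` (values at negative arguments are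
irrelevant). -/
structure IsCongestionFunction (f : ℝ → ℝ) : Prop where
  contDiffOn : ContDiffOn ℝ 1 f (Set.Ioi 0)
  strictConvexOn : StrictConvexOn ℝ (Set.Ici 0) f
  superlinear : Tendsto (fun t => f t / t) atTop atTop
  deriv_zero : Tendsto (deriv f) (𝓝[>] 0) atBot

open Classical in
/-- The congestion functional: `∫_Y f(ν̄(y)) dy` if `ν` is absolutely continuous, `+∞` otherwise.
A function `f` as above is bounded below, so on a bounded `Y` non-integrability of `f(ν̄)` means
that the integral is `+∞`. -/
def congestion (f : ℝ → ℝ) (Y : Set ℝ) (ν : Measure ℝ) : EReal :=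
  if ν ≪ volume ∧ IntegrableOn (fun y => f (density ν y)) Y then
    ((∫ y in Y, f (density ν y) : ℝ) : EReal)
  else ⊤

/-- Probability measures on `ℝ` concentrated on `S`. -/
def probOn (S : Set ℝ) : Set (Measure ℝ) := {ν | IsProbabilityMeasure ν ∧ ν Sᶜ = 0}

/-- `ν` minimizes `T_c(μ, ·) + ∫_Y f` over the probability measures on `closure Y`. -/
def IsMinimizer (Y : Set ℝ) (c : E m → ℝ → ℝ) (μ : Measure (E m)) (f : ℝ → ℝ)
    (ν : Measure ℝ) : Prop :=
  ν ∈ probOn (closure Y) ∧ ∀ ν' ∈ probOn (closure Y),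
    (transportCost c μ ν : EReal) + congestion f Y ν ≤
      (transportCost c μ ν' : EReal) + congestion f Y ν'

/-! ### The lower density bound -/

/-- `(f')⁻¹ : ℝ → (0, ∞)`. -/
def derivInv (f : ℝ → ℝ) : ℝ → ℝ := Function.invFunOn (deriv f) (Set.Ioi 0)

/-- `K_v`, the inverse of `z ↦ ∫_Y (f')⁻¹(z - v(y)) dy`. -/
def K (f : ℝ → ℝ) (Y : Set ℝ) (v : ℝ → ℝ) : ℝ → ℝ :=
  Function.invFun (fun z => ∫ y in Y, derivInv f (z - v y))

/-- The density bound `(f')⁻¹(K_{-M y}(1) - M y)`. -/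
def lowerBound (f : ℝ → ℝ) (Y : Set ℝ) (M y : ℝ) : ℝ :=
  derivInv f (K f Y (fun t => -(M * t)) 1 - M * y)

end Congestion

end

namespace Congestion

/-! ### Congestion functions -/

namespace IsCongestionFunction

variable {f : ℝ → ℝ}

/-! The heart of the matter is an a.e. lower bound on the density `u` of the minimizer, proved by a
mass-moving competitor rather than by dual potentials. Let `M` be the Lipschitz constant of the cost
in `y` and `k = K_{-My}(1)`, and put `l(y) = (f')⁻¹(k - M y)` and `h(y) = (f')⁻¹(k + M y)`. Then `l
≤ h`, and `h` has total mass one by the choice of `k`. Suppose `u < l` on a set of positive measure.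
Since `u` also has mass one, either `u` exceeds `h` somewhere, or `u = h ≥ l` a.e., which is absurd.
In the first case, move a small equal mass from the excess over `h` (density `r`) to the deficit
below `l` (density `s`). Because `|y - y'| ≤ y + y'`, the transport cost grows by at most `M ∫ y r +
M ∫ y s` (`transportCost_move_le`). By convexity the congestion term changes by strictly less than
`∫ s (k - M y) - ∫ r (k + M y)`, in which `k` cancels, leaving exactly the negative of that bound
(`IsCongestionFunction.move_le`). This contradicts minimality, so `u ≥ l` a.e.
(`lowerBound_le_density`).

Nestedness is then a count of mass. As `l` decreases, `ν((y₀, y₁]) ≥ (y₁ - y₀) l(y₁)`, which by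
hypothesis exceeds the minimal mass difference. Hence the level set at `y₁` with level `k_max`
carries less mass than `ν((-∞, y₁])`, which forces `k(y₁) < k_max` and a strict inclusion
(`superGE_subset_superGT`).

The splitting function exists by the intermediate value theorem: non-degeneracy makes the level sets
of `∂c/∂y` Lebesgue null, so the mass of a super-level set is continuous in the level. -/

lemma differentiableAt (hf : IsCongestionFunction f) {t : ℝ} (ht : 0 < t) :
    DifferentiableAt ℝ f t :=
  (hf.contDiffOn.differentiableOn one_ne_zero).differentiableAt (Ioi_mem_nhds ht)

lemma continuousOn_deriv (hf : IsCongestionFunction f) : ContinuousOn (deriv f) (Set.Ioi 0) :=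
  hf.contDiffOn.continuousOn_deriv_of_isOpen isOpen_Ioi le_rfl

lemma strictMonoOn_deriv (hf : IsCongestionFunction f) : StrictMonoOn (deriv f) (Set.Ioi 0) :=
  (hf.strictConvexOn.subset Set.Ioi_subset_Ici_self (convex_Ioi 0)).strictMonoOn_deriv
    fun _ ht => hf.differentiableAt ht

/-- The graph of `f` lies strictly above its tangent lines. -/
lemma tangent_lt (hf : IsCongestionFunction f) {w t : ℝ} (hw : 0 < w) (ht : 0 ≤ t) (hne : t ≠ w) :
    f w + deriv f w * (t - w) < f t := by
  rcases lt_or_gt_of_ne hne with h | h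
  · have := hf.strictConvexOn.slope_lt_deriv ht hw.le h (hf.differentiableAt hw)
    rw [slope_def_field, div_lt_iff₀ (by linarith)] at this
    linarith
  · have := hf.strictConvexOn.deriv_lt_slope hw.le ht h (hf.differentiableAt hw)
    rw [slope_def_field, lt_div_iff₀ (by linarith)] at this
    linarith

lemma tangent_le (hf : IsCongestionFunction f) {w t : ℝ} (hw : 0 < w) (ht : 0 ≤ t) :
    f w + deriv f w * (t - w) ≤ f t := by
  rcases eq_or_ne t w with rfl | h
  · simp
  · exact (hf.tangent_lt hw ht h).le

lemma surjOn_deriv (hf : IsCongestionFunction f) : Set.SurjOn (deriv f) (Set.Ioi 0) Set.univ := by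
  intro z _
  obtain ⟨a, haz, ha⟩ : ∃ a, deriv f a ≤ z ∧ a ∈ Set.Ioi (0 : ℝ) :=
    ((hf.deriv_zero.eventually (eventually_le_atBot z)).and self_mem_nhdsWithin).exists
  obtain ⟨b, hbz, hb⟩ : ∃ b, z ≤ deriv f b ∧ b ∈ Set.Ioi (0 : ℝ) := by
    by_contra! H
    have H' : ∀ b, 0 < b → deriv f b < z := fun b hb => by
      by_contra! h
      exact H b h hb
    -- If `f'` stayed below `z`, the tangent at a large `t`, evaluated at `1`, would give `f t ≤ (|f
    -- 1| + |z|) t`, against superlinear growth.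
    obtain ⟨t, ht, ht1⟩ := ((hf.superlinear.eventually (eventually_ge_atTop (|f 1| + |z| + 1))).and
      (eventually_ge_atTop 1)).exists
    have h1 := hf.tangent_le (w := t) (t := 1) (by linarith) zero_le_one
    have h2 := H' t (by linarith)
    rw [le_div_iff₀ (by linarith)] at ht
    have h3 : deriv f t * (t - 1) ≤ |z| * t :=
      (mul_le_mul_of_nonneg_right (h2.le.trans (le_abs_self z)) (by linarith)).trans
        (mul_le_mul_of_nonneg_left (by linarith) (abs_nonneg z))
    have h4 : f 1 ≤ |f 1| * t := (le_abs_self _).trans (le_mul_of_one_le_right (abs_nonneg _) ht1)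
    linarith
  have := isPreconnected_Ioi.intermediate_value ha hb hf.continuousOn_deriv ⟨haz, hbz⟩
  exact this

lemma derivInv_pos (hf : IsCongestionFunction f) (z : ℝ) : 0 < derivInv f z :=
  Function.invFunOn_mem (hf.surjOn_deriv (Set.mem_univ z))

lemma deriv_derivInv (hf : IsCongestionFunction f) (z : ℝ) : deriv f (derivInv f z) = z :=
  Function.invFunOn_eq (hf.surjOn_deriv (Set.mem_univ z))

lemma derivInv_deriv (hf : IsCongestionFunction f) {t : ℝ} (ht : 0 < t) :
    derivInv f (deriv f t) = t :=
  hf.strictMonoOn_deriv.injOn (hf.derivInv_pos _) ht (hf.deriv_derivInv _)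

lemma strictMono_derivInv (hf : IsCongestionFunction f) : StrictMono (derivInv f) := by
  intro a b hab
  by_contra! h
  have := hf.strictMonoOn_deriv.monotoneOn (hf.derivInv_pos b) (hf.derivInv_pos a) h
  rw [hf.deriv_derivInv, hf.deriv_derivInv] at this
  linarith

/-- A strictly monotone function whose range contains a neighbourhood of each of its values has no
jumps; here the range contains `(0, ∞)`. -/
lemma continuous_derivInv (hf : IsCongestionFunction f) : Continuous (derivInv f) := by
  refine continuous_iff_continuousAt.2 fun z => ?_
  refine (hf.strictMono_derivInv.strictMonoOn Set.univ).continuousAt_of_image_mem_nhds univ_mem ?_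
  refine mem_of_superset (Ioi_mem_nhds (hf.derivInv_pos z)) fun t ht => ?_
  exact ⟨deriv f t, trivial, hf.derivInv_deriv ht⟩

/-- The defining property of `K_v` at mass one, for `v(y) = -M y`. -/
lemma integral_derivInv_K (hf : IsCongestionFunction f) {b M : ℝ} (hb : 0 < b) (hM : 0 ≤ M) :
    ∫ y in Set.Ioo 0 b, derivInv f (K f (Set.Ioo 0 b) (fun t => -(M * t)) 1 + M * y) = 1 := by
  set I : ℝ → ℝ := fun z => ∫ y in Set.Ioo 0 b, derivInv f (z - -(M * y)) with hI
  have hII : ∀ z, I z = ∫ y in (0 : ℝ)..b, derivInv f (z - -(M * y)) := fun z => by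
    rw [intervalIntegral.integral_of_le hb.le, integral_Ioc_eq_integral_Ioo]
  have hcont : Continuous I := by
    rw [funext hII]
    refine intervalIntegral.continuous_parametric_intervalIntegral_of_continuous' ?_ 0 b
    have := hf.continuous_derivInv
    fun_prop
  have hcint : ∀ z, IntervalIntegrable (fun y => derivInv f (z - -(M * y))) volume 0 b := fun z => by
    have := hf.continuous_derivInv
    exact Continuous.intervalIntegrable (by fun_prop) _ _
  have hcst : ∫ _ in (0 : ℝ)..b, b⁻¹ = 1 := by
    rw [intervalIntegral.integral_const]; simp [hb.ne']
  have hd : derivInv f (deriv f b⁻¹) = b⁻¹ := hf.derivInv_deriv (inv_pos.2 hb)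
  -- The uniform density `b⁻¹` calibrates both bounds: with this `z` the integrand is at most `b⁻¹`
  -- on `[0, b]`, and with `z = f'(b⁻¹)` it is at least `b⁻¹`.
  have hlow : I (deriv f b⁻¹ - M * b) ≤ 1 := by
    rw [hII, ← hcst]
    refine intervalIntegral.integral_mono_on hb.le (hcint _) (by simp) fun y hy => ?_
    rw [← hd]
    refine hf.strictMono_derivInv.monotone ?_
    rw [hd]
    nlinarith [mul_le_mul_of_nonneg_left hy.2 hM]
  have hhigh : 1 ≤ I (deriv f b⁻¹) := by
    rw [hII, ← hcst]
    refine intervalIntegral.integral_mono_on hb.le (by simp) (hcint _) fun y hy => ?_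
    conv_lhs => rw [← hd]
    refine hf.strictMono_derivInv.monotone ?_
    nlinarith [mul_nonneg hM hy.1]
  have hex : ∃ z, I z = 1 := mem_range_of_exists_le_of_exists_ge hcont ⟨_, hlow⟩ ⟨_, hhigh⟩
  -- `invFun` is meaningful only at attained values, which is why `1` had to be shown to be one.
  have := Function.invFun_eq hex
  simp only [hI, sub_neg_eq_add] at this
  simpa only [K, sub_neg_eq_add] using this

/-- A congestion function need not be continuous at `0`, but it is measurable on `[0, ∞)`. -/
lemma measurable_comp (hf : IsCongestionFunction f) {α : Type*} [MeasurableSpace α] {u : α → ℝ}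
    (hu : Measurable u) (h0 : ∀ a, 0 ≤ u a) : Measurable fun a => f (u a) := by
  have h1 : Measurable ((Set.Ioi 0).piecewise f fun _ => f 0) :=
    (hf.contDiffOn.continuousOn).measurable_piecewise continuousOn_const measurableSet_Ioi
  have h2 : (fun a => f (u a)) = (Set.Ioi 0).piecewise f (fun _ => f 0) ∘ u := by
    funext a
    rcases (h0 a).eq_or_lt with h | h
    · simp [← h]
    · simp [Set.piecewise, h]
  rw [h2]
  exact h1.comp hu

end IsCongestionFunction

end Congestion

namespace Congestion

/-! ### Level sets of functions without critical points -/

/-- A level set on which the function has no critical point is Lebesgue null. -/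
lemma volume_level_eq_zero {F : Type*} [NormedAddCommGroup F] [NormedSpace ℝ F]
    [FiniteDimensional ℝ F] [MeasurableSpace F] [BorelSpace F] (ρ : Measure F) [ρ.IsAddHaarMeasure]
    {g : F → ℝ} {A : Set F} {t : ℝ} (hA : ∀ x ∈ A, g x = t) (hg : ∀ x ∈ A, fderiv ℝ g x ≠ 0) :
    ρ A = 0 := by
  have hv : ∀ x, ∃ v : F, x ∈ A → fderiv ℝ g x v = -1 := fun x => by
    by_cases hx : x ∈ A
    · obtain ⟨w, hw⟩ : ∃ w, fderiv ℝ g x w ≠ 0 := by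
        by_contra! h
        exact hg x hx (ContinuousLinearMap.ext h)
      exact ⟨-(fderiv ℝ g x w)⁻¹ • w, fun _ => by simp [hw]⟩
    · exact ⟨0, fun h => absurd h hx⟩
  choose v hv using hv
  -- On `A`, where `g = t`, the identity agrees with `x' ↦ x' + (g x' - t) • v x`, so `D x` is also
  -- a derivative of the identity within `A`. It kills `v x`, as `g'(x) (v x) = -1`. A map with
  -- singular derivatives within `A` has null image, and this image is `A` itself.
  set D : F → F →L[ℝ] F :=
    fun x => ContinuousLinearMap.id ℝ F + (fderiv ℝ g x).smulRight (v x) with hD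
  have hderiv : ∀ x ∈ A, HasFDerivWithinAt (id : F → F) (D x) A x := fun x hx => by
    have hdiff : DifferentiableAt ℝ g x := by
      by_contra h
      exact hg x hx (fderiv_zero_of_not_differentiableAt h)
    have h1 : HasFDerivWithinAt (fun x' => x' + (g x' - t) • v x) (D x) A x :=
      (hasFDerivWithinAt_id x A).add
        ((hdiff.hasFDerivAt.hasFDerivWithinAt.sub_const t).smul_const (v x))
    exact h1.congr (fun x' hx' => by simp [hA x' hx']) (by simp [hA x hx])
  have hdet : ∀ x ∈ A, (D x).det = 0 := fun x hx => by
    by_contra h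
    have hvx := hv x hx
    have hinj : D x (v x) = D x 0 := by simp [hD, hvx]
    have h0 : v x = 0 :=
      (LinearMap.equivOfDetNeZero (D x : F →ₗ[ℝ] F) h).injective hinj
    rw [h0] at hvx
    simp at hvx
  simpa using addHaar_image_eq_zero_of_det_fderivWithin_eq_zero ρ hderiv hdet

/-! ### The cost -/

section Cost

variable {m : ℕ} {X : Set (E m)} {Y : Set ℝ} {c : E m → ℝ → ℝ}

lemma IsC2OnClosure.exists_bound {F : Type*} [NormedAddCommGroup F] [NormedSpace ℝ F]
    {Ω : Set F} {g : F → ℝ} (hg : IsC2OnClosure Ω g) (hΩ : IsCompact (closure Ω)) :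
    ∃ C, ∀ p ∈ closure Ω, |g p| ≤ C :=
  hΩ.exists_bound_of_continuousOn hg.continuousOn

lemma IsC2OnClosure.exists_fderiv_bound {F : Type*} [NormedAddCommGroup F] [NormedSpace ℝ F]
    {Ω : Set F} {g : F → ℝ} (hg : IsC2OnClosure Ω g) (hΩ : IsCompact (closure Ω)) :
    ∃ C, ∀ p ∈ Ω, ‖fderiv ℝ g p‖ ≤ C := by
  obtain ⟨G, hG, hGe⟩ := hg.extend 1 one_le_two
  obtain ⟨C, hC⟩ := hΩ.exists_bound_of_continuousOn hG
  refine ⟨C, fun p hp => ?_⟩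
  have := hC p (subset_closure hp)
  rwa [hGe hp, norm_iteratedFDeriv_one] at this

lemma isCompact_closure_prod (hXb : Bornology.IsBounded X) (hYb : Bornology.IsBounded Y) :
    IsCompact (closure (X ×ˢ Y)) :=
  (hXb.prod hYb).isCompact_closure

lemma differentiableAt_cost (hXo : IsOpen X) (hYo : IsOpen Y)
    (hc : IsC2OnClosure (X ×ˢ Y) (fun p : E m × ℝ => c p.1 p.2))
    {x : E m} {y : ℝ} (hx : x ∈ X) (hy : y ∈ Y) :
    DifferentiableAt ℝ (fun p : E m × ℝ => c p.1 p.2) (x, y) :=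
  (hc.contDiffOn.differentiableOn two_ne_zero).differentiableAt
    ((hXo.prod hYo).mem_nhds ⟨hx, hy⟩)

lemma hasDerivAt_cost (hXo : IsOpen X) (hYo : IsOpen Y)
    (hc : IsC2OnClosure (X ×ˢ Y) (fun p : E m × ℝ => c p.1 p.2))
    {x : E m} {y : ℝ} (hx : x ∈ X) (hy : y ∈ Y) :
    HasDerivAt (c x) (fderiv ℝ (fun p : E m × ℝ => c p.1 p.2) (x, y) (0, 1)) y := by
  have h1 := (differentiableAt_cost hXo hYo hc hx hy).hasFDerivAt
  have h2 : HasDerivAt (fun y' : ℝ => (x, y')) ((0 : E m), (1 : ℝ)) y :=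
    (hasDerivAt_const y x).prodMk (hasDerivAt_id y)
  exact h1.comp_hasDerivAt y h2

lemma dy_eq_fderiv (hXo : IsOpen X) (hYo : IsOpen Y)
    (hc : IsC2OnClosure (X ×ˢ Y) (fun p : E m × ℝ => c p.1 p.2))
    {x : E m} {y : ℝ} (hx : x ∈ X) (hy : y ∈ Y) :
    dy c x y = fderiv ℝ (fun p : E m × ℝ => c p.1 p.2) (x, y) (0, 1) :=
  (hasDerivAt_cost hXo hYo hc hx hy).deriv

lemma exists_dy_bound (hXo : IsOpen X) (hYo : IsOpen Y)
    (hc : IsC2OnClosure (X ×ˢ Y) (fun p : E m × ℝ => c p.1 p.2))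
    (hXb : Bornology.IsBounded X) (hYb : Bornology.IsBounded Y) :
    ∃ C, 0 ≤ C ∧ ∀ x ∈ X, ∀ y ∈ Y, |dy c x y| ≤ C := by
  obtain ⟨C, hC⟩ := hc.exists_fderiv_bound (isCompact_closure_prod hXb hYb)
  refine ⟨max C 0, le_max_right _ _, fun x hx y hy => ?_⟩
  rw [dy_eq_fderiv hXo hYo hc hx hy, ← Real.norm_eq_abs]
  refine (ContinuousLinearMap.le_opNorm _ _).trans ?_
  have h1 : ‖((0 : E m), (1 : ℝ))‖ = 1 := by simp [Prod.norm_def]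
  rw [h1, mul_one]
  exact (hC (x, y) ⟨hx, hy⟩).trans (le_max_left _ _)

lemma continuousOn_dy (hXo : IsOpen X) (hYo : IsOpen Y)
    (hc : IsC2OnClosure (X ×ˢ Y) (fun p : E m × ℝ => c p.1 p.2))
    {y : ℝ} (hy : y ∈ Y) : ContinuousOn (fun x => dy c x y) X := by
  have h1 : ContinuousOn (fderiv ℝ (fun p : E m × ℝ => c p.1 p.2)) (X ×ˢ Y) :=
    hc.contDiffOn.continuousOn_fderiv_of_isOpen (hXo.prod hYo) one_le_two
  have h2 : ContinuousOn
      (fun x => fderiv ℝ (fun p : E m × ℝ => c p.1 p.2) (x, y) ((0 : E m), (1 : ℝ))) X :=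
    (h1.comp (f := fun x => (x, y)) (by fun_prop) fun x hx => ⟨hx, hy⟩).clm_apply continuousOn_const
  exact h2.congr fun x hx => dy_eq_fderiv hXo hYo hc hx hy

lemma measurableSet_superGE (hXo : IsOpen X) (hYo : IsOpen Y)
    (hc : IsC2OnClosure (X ×ˢ Y) (fun p : E m × ℝ => c p.1 p.2))
    {y k : ℝ} (hy : y ∈ Y) : MeasurableSet (superGE X c y k) := by
  have h := continuousOn_dy hXo hYo hc hy
  obtain ⟨t, ht, hte⟩ := (continuousOn_iff_isClosed.1 h) (Set.Ici k) isClosed_Ici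
  have : superGE X c y k = t ∩ X := by
    rw [← hte]
    ext x
    simp [superGE, and_comm]
  rw [this]
  exact ht.measurableSet.inter hXo.measurableSet

/-- The mixed derivative is continuous in the interior. -/
lemma continuousOn_mixed (hXo : IsOpen X) (hYo : IsOpen Y)
    (hc : IsC2OnClosure (X ×ˢ Y) (fun p : E m × ℝ => c p.1 p.2)) :
    ContinuousOn (mixed c) (X ×ˢ Y) := by
  set g : E m × ℝ → ℝ := fun p => c p.1 p.2
  have hO : IsOpen (X ×ˢ Y) := hXo.prod hYo
  have hG : ContDiffOn ℝ 1 (fun q => fderiv ℝ g q ((0 : E m), (1 : ℝ))) (X ×ˢ Y) :=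
    (hc.contDiffOn.fderiv_of_isOpen hO (m := 1) (by norm_num)).clm_apply contDiffOn_const
  have hG' := hG.continuousOn_fderiv_of_isOpen hO le_rfl
  have h1 : ContinuousOn (fun p => (fderiv ℝ (fun q => fderiv ℝ g q ((0 : E m), (1 : ℝ))) p).comp
      (ContinuousLinearMap.inl ℝ (E m) ℝ)) (X ×ˢ Y) :=
    hG'.clm_comp continuousOn_const
  refine h1.congr fun p hp => ?_
  obtain ⟨x, y⟩ := p
  have hd := ((hG.differentiableOn one_ne_zero).differentiableAt (hO.mem_nhds hp)).hasFDerivAt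
  have hcomp : HasFDerivAt (fun x' => fderiv ℝ g (x', y) ((0 : E m), (1 : ℝ)))
      ((fderiv ℝ (fun q => fderiv ℝ g q ((0 : E m), (1 : ℝ))) (x, y)).comp
        (ContinuousLinearMap.inl ℝ (E m) ℝ)) x :=
    hd.comp x (f := fun x' => (x', y)) (hasFDerivAt_prodMk_left x y)
  refine (hcomp.congr_of_eventuallyEq ?_).fderiv
  filter_upwards [hXo.mem_nhds hp.1] with x' hx'
  exact dy_eq_fderiv hXo hYo hc hx' hp.2

/-- At an interior point continuity makes `extendFrom` return the actual mixed derivative, so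
non-degeneracy of the extension applies to it. -/
lemma mixed_ne_zero (hXo : IsOpen X) (hYo : IsOpen Y)
    (hc : IsC2OnClosure (X ×ˢ Y) (fun p : E m × ℝ => c p.1 p.2))
    (hnondeg : Nondegenerate X Y c) {x : E m} {y : ℝ} (hx : x ∈ X) (hy : y ∈ Y) :
    fderiv ℝ (fun x' => dy c x' y) x ≠ 0 := by
  have h1 := hnondeg (x, y) ⟨subset_closure hx, subset_closure hy⟩
  have hp : (x, y) ∈ X ×ˢ Y := ⟨hx, hy⟩
  rwa [extendFrom_eq (subset_closure hp) (continuousOn_mixed hXo hYo hc (x, y) hp)] at h1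

/-- A real `sSup` dominates its set only if the set is bounded above. The mean value inequality
bounds the quotients in the interior, and continuity of `c` carries the bound to the closures. -/
lemma abs_cost_sub_le_lipConst (hXo : IsOpen X) (hYo : IsOpen Y)
    (hc : IsC2OnClosure (X ×ˢ Y) (fun p : E m × ℝ => c p.1 p.2))
    (hXb : Bornology.IsBounded X) (hYb : Bornology.IsBounded Y)
    (hYc : Convex ℝ Y) {x : E m} (hx : x ∈ X) {y₀ y₁ : ℝ} (h₀ : y₀ ∈ Y) (h₁ : y₁ ∈ Y) :
    |c x y₀ - c x y₁| ≤ lipConst X Y c * |y₀ - y₁| := by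
  obtain ⟨C, hC0, hC⟩ := exists_dy_bound hXo hYo hc hXb hYb
  have hcint : ∀ x ∈ X, ∀ y₀ ∈ Y, ∀ y₁ ∈ Y, |c x y₀ - c x y₁| ≤ C * |y₀ - y₁| := by
    intro x hx y₀ h₀ y₁ h₁
    exact hYc.norm_image_sub_le_of_norm_deriv_le
      (fun y hy => (hasDerivAt_cost hXo hYo hc hx hy).differentiableAt)
      (fun y hy => hC x hx y hy) h₁ h₀
  have hbd : BddAbove {r | ∃ x ∈ closure X, ∃ y₀ ∈ closure Y, ∃ y₁ ∈ closure Y,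
      r = |c x y₀ - c x y₁| / |y₀ - y₁|} := by
    refine ⟨C, ?_⟩
    rintro _ ⟨x, hx, y₀, h₀, y₁, h₁, rfl⟩
    refine div_le_of_le_mul₀ (abs_nonneg _) hC0 ?_
    have hcl : closure (X ×ˢ (Y ×ˢ Y)) = closure X ×ˢ (closure Y ×ˢ closure Y) := by
      rw [closure_prod_eq, closure_prod_eq]
    have hcc := hc.continuousOn
    rw [closure_prod_eq] at hcc
    refine le_on_closure (s := X ×ˢ (Y ×ˢ Y))
      (f := fun q : E m × ℝ × ℝ => |c q.1 q.2.1 - c q.1 q.2.2|)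
      (g := fun q : E m × ℝ × ℝ => C * |q.2.1 - q.2.2|) (x := (x, y₀, y₁))
      (fun q hq => hcint q.1 hq.1 q.2.1 hq.2.1 q.2.2 hq.2.2) ?_ (by fun_prop) ?_
    · rw [hcl]
      refine ContinuousOn.abs (ContinuousOn.sub ?_ ?_)
      · exact hcc.comp (f := fun q : E m × ℝ × ℝ => (q.1, q.2.1)) (by fun_prop)
          fun q hq => ⟨hq.1, hq.2.1⟩
      · exact hcc.comp (f := fun q : E m × ℝ × ℝ => (q.1, q.2.2)) (by fun_prop)
          fun q hq => ⟨hq.1, hq.2.2⟩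
    · rw [hcl]
      exact ⟨hx, h₀, h₁⟩
  rcases eq_or_ne y₀ y₁ with rfl | hne
  · simp
  · rw [← div_le_iff₀ (abs_pos.2 (sub_ne_zero.2 hne))]
    exact le_csSup hbd ⟨x, subset_closure hx, y₀, subset_closure h₀, y₁, subset_closure h₁, rfl⟩

lemma lipConst_nonneg : 0 ≤ lipConst X Y c := by
  refine Real.sSup_nonneg ?_
  rintro _ ⟨x, -, y₀, -, y₁, -, rfl⟩
  positivity

/-- The mass of the super-level sets depends continuously on the level. -/
lemma continuous_measure_superGE (hXo : IsOpen X) (hYo : IsOpen Y)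
    (hc : IsC2OnClosure (X ×ˢ Y) (fun p : E m × ℝ => c p.1 p.2))
    (hnondeg : Nondegenerate X Y c) (μ : Measure (E m))
    [IsFiniteMeasure μ] (hμ : μ ≪ volume) {y : ℝ} (hy : y ∈ Y) :
    Continuous fun k => μ.real (superGE X c y k) := by
  have hmeas : ∀ k, MeasurableSet (superGE X c y k) :=
    fun k => measurableSet_superGE hXo hYo hc hy
  have hcint : (fun k => μ.real (superGE X c y k)) =
      fun k => ∫ x, (superGE X c y k).indicator (fun _ => (1 : ℝ)) x ∂μ := by
    funext k
    rw [integral_indicator_const _ (hmeas k)]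
    simp
  rw [hcint]
  refine continuous_iff_continuousAt.2 fun k => ?_
  -- Dominated convergence: for fixed `x` the indicator jumps only at the level `dy c x y`, and the
  -- `x` for which this equals `k` form a null set.
  refine continuousAt_of_dominated (bound := fun _ => 1)
    (Eventually.of_forall fun k => (measurable_const.indicator (hmeas k)).aestronglyMeasurable)
    (Eventually.of_forall fun k => ae_of_all _ fun x => ?_) (integrable_const _) ?_
  · by_cases hx : x ∈ superGE X c y k <;> simp [hx]
  · have hnull : μ {x ∈ X | dy c x y = k} = 0 :=
      hμ (volume_level_eq_zero volume (g := fun x => dy c x y) (t := k) (fun x hx => hx.2)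
        fun x hx => mixed_ne_zero hXo hYo hc hnondeg hx.1 hy)
    filter_upwards [measure_eq_zero_iff_ae_notMem.1 hnull] with x hx
    by_cases hxX : x ∈ X
    · have hne : dy c x y ≠ k := fun h => hx ⟨hxX, h⟩
      rcases lt_or_gt_of_ne hne with h | h
      · refine (continuousAt_const (y := (0 : ℝ))).congr ?_
        filter_upwards [Ioi_mem_nhds h] with k' hk'
        rw [Set.indicator_of_notMem]
        exact fun hh => absurd hh.2 (not_le.2 hk')
      · refine (continuousAt_const (y := (1 : ℝ))).congr ?_
        filter_upwards [Iio_mem_nhds h] with k' hk'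
        rw [Set.indicator_of_mem]
        exact ⟨hxX, le_of_lt hk'⟩
    · refine (continuousAt_const (y := (0 : ℝ))).congr (Eventually.of_forall fun k' => ?_)
      exact (Set.indicator_of_notMem (fun hh => hxX hh.1) _).symm

/-- Existence of the mass-splitting function. -/
lemma exists_isSplitting (hXo : IsOpen X) (hYo : IsOpen Y)
    (hc : IsC2OnClosure (X ×ˢ Y) (fun p : E m × ℝ => c p.1 p.2))
    (hXb : Bornology.IsBounded X) (hYb : Bornology.IsBounded Y)
    (hnondeg : Nondegenerate X Y c) (μ : Measure (E m)) [IsProbabilityMeasure μ]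
    (hμX : μ Xᶜ = 0) (hμ : μ ≪ volume) (ν : Measure ℝ) [IsProbabilityMeasure ν] :
    ∃ k, IsSplitting X Y c μ ν k := by
  obtain ⟨C, -, hC⟩ := exists_dy_bound hXo hYo hc hXb hYb
  have key : ∀ y, ∃ k, y ∈ Y → μ (superGE X c y k) = ν (Set.Iic y) := fun y => by
    by_cases hy : y ∈ Y
    swap
    · exact ⟨0, fun h => absurd h hy⟩
    have hcont := continuous_measure_superGE hXo hYo hc hnondeg μ hμ hy
    -- The levels `C + 1` and `-C` give masses `0` and `1`, the endpoints for the intermediate value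
    -- theorem.
    have h0 : superGE X c y (C + 1) = ∅ := by
      ext x
      simp only [superGE, Set.mem_ofPred_eq, Set.mem_empty_iff_false, iff_false, not_and, not_le]
      intro hx
      linarith [le_abs_self (dy c x y), hC x hx y hy]
    have h1 : superGE X c y (-C) = X := by
      ext x
      simp only [superGE, Set.mem_ofPred_eq, and_iff_left_iff_imp]
      intro hx
      linarith [neg_abs_le (dy c x y), hC x hx y hy]
    have hX1 : μ.real X = 1 := by
      rw [measureReal_def, (prob_compl_eq_zero_iff hXo.measurableSet).1 hμX]
      simp
    obtain ⟨k, hk⟩ : ∃ k, μ.real (superGE X c y k) = ν.real (Set.Iic y) :=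
      mem_range_of_exists_le_of_exists_ge hcont ⟨C + 1, by simp [h0]⟩
        ⟨-C, by rw [h1, hX1]; exact measureReal_le_one⟩
    exact ⟨k, fun _ => (measureReal_eq_measureReal_iff).1 hk⟩
  choose k hk using key
  exact ⟨k, fun y hy => hk y hy⟩

end Cost

end Congestion

namespace Congestion

/-! ### Rerouting part of a transport plan -/

lemma integrable_of_continuousOn_of_bounded {α : Type*} [TopologicalSpace α] [MeasurableSpace α]
    [OpensMeasurableSpace α] {g : α → ℝ} {Ω : Set α} (hΩ : MeasurableSet Ω)
    (hg : ContinuousOn g Ω) {C : ℝ} (hC : ∀ p ∈ Ω, |g p| ≤ C) (γ : Measure α) [IsFiniteMeasure γ]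
    (hγ : ∀ᵐ p ∂γ, p ∈ Ω) : Integrable g γ := by
  refine Integrable.of_bound ?_ C (hγ.mono fun p hp => hC p hp)
  rw [← Measure.restrict_eq_self_of_ae_mem hγ]
  exact hg.aestronglyMeasurable hΩ

/-- Replace the part `γ₁` of the plan `γ₀ + γ₁` by the product of its first marginal with `σ`. -/
noncomputable def reroute {m : ℕ} (γ₀ γ₁ : Measure (E m × ℝ)) (σ : Measure ℝ) : Measure (E m × ℝ) :=
  γ₀ + (γ₁ Set.univ)⁻¹ • (γ₁.map Prod.fst).prod σ

section Reroute

variable {m : ℕ} {γ₀ γ₁ : Measure (E m × ℝ)} {σ : Measure ℝ}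
  [IsFiniteMeasure γ₁] [IsFiniteMeasure σ]

lemma map_fst_reroute (hσ : σ Set.univ = γ₁ Set.univ) (h0 : γ₁ Set.univ ≠ 0) :
    (reroute γ₀ γ₁ σ).map Prod.fst = (γ₀ + γ₁).map Prod.fst := by
  rw [reroute, Measure.map_add _ _ measurable_fst, Measure.map_add _ _ measurable_fst,
    Measure.map_smul, Measure.map_fst_prod, hσ, smul_smul,
    ENNReal.inv_mul_cancel h0 (measure_ne_top _ _), one_smul]

lemma map_snd_reroute (h0 : γ₁ Set.univ ≠ 0) :
    (reroute γ₀ γ₁ σ).map Prod.snd = γ₀.map Prod.snd + σ := by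
  rw [reroute, Measure.map_add _ _ measurable_snd, Measure.map_smul, Measure.map_snd_prod,
    Measure.map_apply measurable_fst MeasurableSet.univ, Set.preimage_univ, smul_smul,
    ENNReal.inv_mul_cancel h0 (measure_ne_top _ _), one_smul]

/-- The extra cost caused by rerouting, for a cost which is `M`-Lipschitz in `y ∈ (0, b)`. -/
lemma integral_reroute_le [IsFiniteMeasure γ₀] (hσ : σ Set.univ = γ₁ Set.univ) (h0 : γ₁ Set.univ ≠ 0)
    {X : Set (E m)} (hXm : MeasurableSet X) {b M : ℝ} {c : E m → ℝ → ℝ} (hM : 0 ≤ M)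
    (hlip : ∀ x ∈ X, ∀ y ∈ Set.Ioo 0 b, ∀ y' ∈ Set.Ioo 0 b, |c x y - c x y'| ≤ M * |y - y'|)
    (hcint : ∀ γ : Measure (E m × ℝ), IsFiniteMeasure γ → (∀ᵐ p ∂γ, p ∈ X ×ˢ Set.Ioo 0 b) →
      Integrable (fun p => c p.1 p.2) γ)
    (h₀ : ∀ᵐ p ∂γ₀, p ∈ X ×ˢ Set.Ioo 0 b) (h₁ : ∀ᵐ p ∂γ₁, p ∈ X ×ˢ Set.Ioo 0 b)
    (hσY : ∀ᵐ y ∂σ, y ∈ Set.Ioo 0 b) :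
    ∫ p, c p.1 p.2 ∂(reroute γ₀ γ₁ σ) ≤
      ∫ p, c p.1 p.2 ∂(γ₀ + γ₁) + M * ∫ y, y ∂(γ₁.map Prod.snd) + M * ∫ y, y ∂σ := by
  -- Under `P` the old destination `q.1.2` and the new one `q.2` live on one space, so the two costs
  -- can be compared pointwise. Its mass is the square of that of `γ₁`; the factor in `reroute`
  -- corrects this.
  set P := γ₁.prod σ
  have hPae : ∀ᵐ q ∂P, q.1 ∈ X ×ˢ Set.Ioo 0 b ∧ q.2 ∈ Set.Ioo 0 b :=
    (Measure.quasiMeasurePreserving_fst.ae h₁).and (Measure.quasiMeasurePreserving_snd.ae hσY)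
  have hφ : Measurable (fun q : (E m × ℝ) × ℝ => (q.1.1, q.2)) := by fun_prop
  have hπ : (γ₁.map Prod.fst).prod σ = P.map fun q => (q.1.1, q.2) := by
    have := Measure.map_prod_map γ₁ σ (f := Prod.fst) (g := id) measurable_fst measurable_id
    rw [Measure.map_id] at this
    exact this
  have hπae : ∀ᵐ p ∂(P.map fun q => (q.1.1, q.2)), p ∈ X ×ˢ Set.Ioo 0 b :=
    (ae_map_iff hφ.aemeasurable (hXm.prod measurableSet_Ioo)).2
      (hPae.mono fun q hq => ⟨hq.1.1, hq.2⟩)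
  have hc₀ := hcint γ₀ inferInstance h₀
  have hc₁ := hcint γ₁ inferInstance h₁
  have hcπ := hcint (P.map fun q => (q.1.1, q.2)) inferInstance hπae
  have hy₁ : Integrable (fun p : E m × ℝ => p.2) γ₁ :=
    Integrable.of_bound measurable_snd.aestronglyMeasurable b
      (h₁.mono fun p hp => by rw [Real.norm_eq_abs, abs_of_pos hp.2.1]; exact hp.2.2.le)
  have hyσ : Integrable (fun y : ℝ => y) σ :=
    Integrable.of_bound measurable_id.aestronglyMeasurable b
      (hσY.mono fun p hp => by rw [Real.norm_eq_abs, abs_of_pos hp.1]; exact hp.2.le)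
  set t := γ₁.real Set.univ with ht
  have htσ : σ.real Set.univ = t := by rw [ht, measureReal_def, hσ, measureReal_def]
  have ht0 : 0 < t := ENNReal.toReal_pos h0 (measure_ne_top _ _)
  have hmain : ∫ p, c p.1 p.2 ∂((γ₁.map Prod.fst).prod σ) ≤
      t * (∫ p, c p.1 p.2 ∂γ₁ + M * ∫ p, p.2 ∂γ₁ + M * ∫ y, y ∂σ) := by
    rw [hπ, integral_map hφ.aemeasurable hcπ.aestronglyMeasurable]
    have hF : Integrable (fun q : (E m × ℝ) × ℝ => c q.1.1 q.1.2 + M * q.1.2) P :=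
      (hc₁.add (hy₁.const_mul M)).comp_fst σ
    have hG : Integrable (fun q : (E m × ℝ) × ℝ => M * q.2) P := (hyσ.const_mul M).comp_snd γ₁
    calc ∫ q, c q.1.1 q.2 ∂P ≤ ∫ q, ((c q.1.1 q.1.2 + M * q.1.2) + M * q.2) ∂P := by
          refine integral_mono_ae ((integrable_map_measure hcπ.aestronglyMeasurable
            hφ.aemeasurable).1 hcπ) (hF.add hG) (hPae.mono fun q hq => ?_)
          have h1 := (abs_le.1 (hlip q.1.1 hq.1.1 q.1.2 hq.1.2 q.2 hq.2)).1
          -- This bound, valid for positive points, separates source from destination, so only the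
          -- two first moments enter.
          have h2 : |q.1.2 - q.2| ≤ q.1.2 + q.2 := by
            rw [abs_le]
            constructor <;> linarith [hq.1.2.1, hq.2.1]
          have h3 := mul_le_mul_of_nonneg_left h2 hM
          simp only
          linarith
      _ = t * (∫ p, c p.1 p.2 ∂γ₁ + M * ∫ p, p.2 ∂γ₁ + M * ∫ y, y ∂σ) := by
          rw [integral_add hF hG,
            integral_fun_fst (fun p : E m × ℝ => c p.1 p.2 + M * p.2),
            integral_fun_snd (fun y : ℝ => M * y), htσ,
            integral_add hc₁ (hy₁.const_mul M), integral_const_mul, integral_const_mul]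
          simp only [smul_eq_mul, ← ht]
          ring
  have hsm : Integrable (fun p => c p.1 p.2)
      ((γ₁ Set.univ)⁻¹ • (γ₁.map Prod.fst).prod σ) := by
    rw [hπ]
    exact hcπ.smul_measure (ENNReal.inv_ne_top.2 h0)
  rw [reroute, integral_add_measure hc₀ hsm, integral_add_measure hc₀ hc₁, integral_smul_measure,
    integral_map (f := fun y : ℝ => y) measurable_snd.aemeasurable
      measurable_id.aestronglyMeasurable]
  have : (γ₁ Set.univ)⁻¹.toReal • ∫ p, c p.1 p.2 ∂((γ₁.map Prod.fst).prod σ) ≤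
      ∫ p, c p.1 p.2 ∂γ₁ + M * ∫ p, p.2 ∂γ₁ + M * ∫ y, y ∂σ := by
    rw [ENNReal.toReal_inv, smul_eq_mul, ← measureReal_def, ← ht, inv_mul_le_iff₀ ht0]
    exact hmain
  linarith

end Reroute

/-- Used to cut a plan according to its second coordinate while keeping track of the second
marginal. -/
lemma map_withDensity_comp {α β : Type*} [MeasurableSpace α] [MeasurableSpace β] (γ : Measure α)
    {g : α → β} (hg : Measurable g) {w : β → ENNReal} (hw : Measurable w) :
    (γ.withDensity (w ∘ g)).map g = (γ.map g).withDensity w := by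
  ext s hs
  rw [Measure.map_apply hg hs, withDensity_apply _ (hg hs), withDensity_apply _ hs,
    setLIntegral_map hs hw hg]
  rfl

lemma isFiniteMeasure_of_mem_plans {m : ℕ} {μ : Measure (E m)} [IsFiniteMeasure μ] {ν : Measure ℝ}
    {γ : Measure (E m × ℝ)} (hγ : γ ∈ plans μ ν) : IsFiniteMeasure γ := by
  have h : IsFiniteMeasure (γ.map Prod.fst) := by rw [hγ.1]; infer_instance
  exact (Measure.isFiniteMeasure_map_iff measurable_fst.aemeasurable).1 h

lemma ae_mem_prod_of_mem_plans {m : ℕ} {μ : Measure (E m)} {ν : Measure ℝ}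
    {γ : Measure (E m × ℝ)} (hγ : γ ∈ plans μ ν) {X : Set (E m)} {Y : Set ℝ}
    (hX : ∀ᵐ x ∂μ, x ∈ X) (hY : ∀ᵐ y ∂ν, y ∈ Y) : ∀ᵐ p ∂γ, p ∈ X ×ˢ Y := by
  rw [← hγ.1] at hX
  rw [← hγ.2] at hY
  filter_upwards [ae_of_ae_map measurable_fst.aemeasurable hX,
    ae_of_ae_map measurable_snd.aemeasurable hY] with p h1 h2
  exact ⟨h1, h2⟩

/-- Moving the mass `r` to `s` in the target density changes the transport cost by at most
`M ∫ y r(y) dy + M ∫ y s(y) dy`. -/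
lemma transportCost_move_le {m : ℕ} {X : Set (E m)} (hXm : MeasurableSet X) {b M C : ℝ}
    {c : E m → ℝ → ℝ} (hM : 0 ≤ M)
    (hlip : ∀ x ∈ X, ∀ y ∈ Set.Ioo 0 b, ∀ y' ∈ Set.Ioo 0 b, |c x y - c x y'| ≤ M * |y - y'|)
    (hcint : ∀ γ : Measure (E m × ℝ), IsFiniteMeasure γ → (∀ᵐ p ∂γ, p ∈ X ×ˢ Set.Ioo 0 b) →
      Integrable (fun p => c p.1 p.2) γ)
    (hC : ∀ x ∈ X, ∀ y ∈ Set.Ioo 0 b, |c x y| ≤ C)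
    (μ : Measure (E m)) [IsProbabilityMeasure μ] (hμX : ∀ᵐ x ∂μ, x ∈ X)
    {u r s : ℝ → ℝ} (hu : Measurable u) (hr : Measurable r) (hs : Measurable s)
    (hr0 : ∀ y, 0 ≤ r y) (hru : ∀ y, r y ≤ u y) (hs0 : ∀ y, 0 ≤ s y)
    (hν : IsProbabilityMeasure (volume.withDensity fun y => ENNReal.ofReal (u y)))
    (hνY : ∀ᵐ y ∂(volume.withDensity fun y => ENNReal.ofReal (u y)), y ∈ Set.Ioo 0 b)
    (hsY : ∀ y ∉ Set.Ioo 0 b, s y = 0) (hri : Integrable r) (hsi : Integrable s)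
    (hrs : ∫ y, r y = ∫ y, s y) (hpos : 0 < ∫ y, r y) :
    transportCost c μ (volume.withDensity fun y => ENNReal.ofReal (u y - r y + s y)) ≤
      transportCost c μ (volume.withDensity fun y => ENNReal.ofReal (u y)) +
        M * (∫ y, r y * y) + M * ∫ y, s y * y := by
  set ν := volume.withDensity fun y => ENNReal.ofReal (u y) with hνdef
  set σ := volume.withDensity fun y => ENNReal.ofReal (s y) with hσdef
  have : IsFiniteMeasure σ := isFiniteMeasure_withDensity_ofReal hsi.2
  have hu0 : ∀ y, 0 ≤ u y := fun y => (hr0 y).trans (hru y)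
  -- The fraction of the mass at `y` that leaves. Where `u y = 0` the quotient is `0`, which is
  -- right because `r ≤ u` forces `r y = 0`.
  set w : ℝ → ENNReal := fun y => ENNReal.ofReal (r y / u y) with hw
  set w' : ℝ → ENNReal := fun y => ENNReal.ofReal (1 - r y / u y) with hw'
  have hwm : Measurable w := (hr.div hu).ennreal_ofReal
  have hwm' : Measurable w' := (measurable_const.sub (hr.div hu)).ennreal_ofReal
  have hratio : ∀ y, 0 ≤ r y / u y ∧ r y / u y ≤ 1 := fun y =>
    ⟨div_nonneg (hr0 y) (hu0 y), div_le_one_of_le₀ (hru y) (hu0 y)⟩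
  have hratio_mul : ∀ y, u y * (r y / u y) = r y := fun y => by
    rcases eq_or_ne (u y) 0 with h | h
    · rw [h, zero_mul]
      exact le_antisymm (hr0 y) (h ▸ hru y)
    · field_simp
  have hww : w' + w = 1 := by
    funext y
    simp only [Pi.add_apply, Pi.one_apply, hw, hw']
    rw [← ENNReal.ofReal_add (by linarith [(hratio y).2]) (hratio y).1]
    simp
  have hνw : ν.withDensity w = volume.withDensity fun y => ENNReal.ofReal (r y) := by
    rw [hνdef, ← withDensity_mul _ hu.ennreal_ofReal hwm]
    congr 1
    funext y
    simp only [Pi.mul_apply, hw]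
    rw [← ENNReal.ofReal_mul (hu0 y), hratio_mul]
  have hνw' : ν.withDensity w' = volume.withDensity fun y => ENNReal.ofReal (u y - r y) := by
    rw [hνdef, ← withDensity_mul _ hu.ennreal_ofReal hwm']
    congr 1
    funext y
    simp only [Pi.mul_apply, hw']
    rw [← ENNReal.ofReal_mul (hu0 y), mul_sub, hratio_mul, mul_one]
  have hnew : ν.withDensity w' + σ =
      volume.withDensity fun y => ENNReal.ofReal (u y - r y + s y) := by
    have hm : Measurable fun y => ENNReal.ofReal (u y - r y) := (hu.sub hr).ennreal_ofReal
    rw [hνw', hσdef, ← withDensity_add_left hm]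
    congr 1
    funext y
    simp only [Pi.add_apply]
    rw [ENNReal.ofReal_add (by linarith [hru y]) (hs0 y)]
  have hmass : ∀ {t : ℝ → ℝ}, Integrable t → (∀ y, 0 ≤ t y) →
      (volume.withDensity fun y => ENNReal.ofReal (t y)) Set.univ = ENNReal.ofReal (∫ y, t y) := by
    intro t hti ht0
    rw [withDensity_apply _ MeasurableSet.univ, Measure.restrict_univ,
      ofReal_integral_eq_lintegral_ofReal hti (ae_of_all _ ht0)]
  have hmean : ∀ {t : ℝ → ℝ}, Measurable t → (∀ y, 0 ≤ t y) →
      ∫ y, y ∂(volume.withDensity fun y => ENNReal.ofReal (t y)) = ∫ y, t y * y := by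
    intro t ht ht0
    rw [integral_withDensity_eq_integral_toReal_smul ht.ennreal_ofReal (by simp)]
    simp only [ENNReal.toReal_ofReal (ht0 _), smul_eq_mul]
  have hσY : ∀ᵐ y ∂σ, y ∈ Set.Ioo 0 b := by
    rw [hσdef, ae_withDensity_iff hs.ennreal_ofReal]
    refine ae_of_all _ fun y hy => ?_
    by_contra h
    exact hy (by simp [hsY y h])
  have hνY' : ∀ᵐ y ∂(ν.withDensity w' + σ), y ∈ Set.Ioo 0 b := by
    rw [ae_add_measure_iff]
    exact ⟨(withDensity_absolutelyContinuous ν w').ae_le hνY, hσY⟩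
  rw [← hnew]
  have hbdd : BddBelow ((fun γ : Measure (E m × ℝ) => ∫ p, c p.1 p.2 ∂γ) ''
      plans μ (ν.withDensity w' + σ)) := by
    refine ⟨-C, ?_⟩
    rintro _ ⟨γ, hγ, rfl⟩
    have hfin := isFiniteMeasure_of_mem_plans hγ
    have hprob : γ.real Set.univ = 1 := by
      have h1 : γ.map Prod.fst Set.univ = 1 := by rw [hγ.1]; exact measure_univ
      rw [Measure.map_apply measurable_fst MeasurableSet.univ, Set.preimage_univ] at h1
      simp [measureReal_def, h1]
    have hae := ae_mem_prod_of_mem_plans hγ hμX hνY'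
    have h1 : ∫ _, (-C) ∂γ ≤ ∫ p, c p.1 p.2 ∂γ :=
      integral_mono_ae (integrable_const _) (hcint γ hfin hae)
        (hae.mono fun p hp => (abs_le.1 (hC p.1 hp.1 p.2 hp.2)).1)
    simpa [hprob] using h1
  rw [add_assoc, ← sub_le_iff_le_add]
  refine le_csInf ⟨_, μ.prod ν, ⟨by simp, by simp⟩, rfl⟩ ?_
  -- No optimal plan is needed: every plan for the old target is split by `w'` and `w`, and the
  -- leaving part is rerouted into a plan for the new target.
  rintro _ ⟨γ, hγ, rfl⟩
  have hfin := isFiniteMeasure_of_mem_plans hγ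
  have hae := ae_mem_prod_of_mem_plans hγ hμX hνY
  set γ₀ := γ.withDensity (w' ∘ Prod.snd) with hγ₀
  set γ₁ := γ.withDensity (w ∘ Prod.snd) with hγ₁
  have hsum : γ₀ + γ₁ = γ := by
    rw [hγ₀, hγ₁, ← withDensity_add_left (hwm'.comp measurable_snd)]
    have : w' ∘ Prod.snd + w ∘ Prod.snd = (1 : E m × ℝ → ENNReal) := by
      funext p
      exact congrFun hww p.2
    rw [this, withDensity_one]
  have hfin₀ : IsFiniteMeasure γ₀ := isFiniteMeasure_of_le γ (hsum ▸ Measure.le_add_right le_rfl)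
  have hfin₁ : IsFiniteMeasure γ₁ := isFiniteMeasure_of_le γ (hsum ▸ Measure.le_add_left le_rfl)
  have hsnd₀ : γ₀.map Prod.snd = ν.withDensity w' := by
    rw [hγ₀, map_withDensity_comp γ measurable_snd hwm', hγ.2]
  have hsnd₁ : γ₁.map Prod.snd = volume.withDensity fun y => ENNReal.ofReal (r y) := by
    rw [hγ₁, map_withDensity_comp γ measurable_snd hwm, hγ.2, hνw]
  have hm₁ : γ₁ Set.univ = ENNReal.ofReal (∫ y, r y) := by
    rw [← hmass hri hr0, ← hsnd₁, Measure.map_apply measurable_snd MeasurableSet.univ,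
      Set.preimage_univ]
  have hmσ : σ Set.univ = γ₁ Set.univ := by rw [hm₁, hrs, hσdef, hmass hsi hs0]
  have hne : γ₁ Set.univ ≠ 0 := by rw [hm₁]; simpa using hpos
  have hplan : reroute γ₀ γ₁ σ ∈ plans μ (ν.withDensity w' + σ) :=
    ⟨by rw [map_fst_reroute hmσ hne, hsum, hγ.1], by rw [map_snd_reroute hne, hsnd₀]⟩
  have hle := integral_reroute_le (γ₀ := γ₀) hmσ hne hXm hM hlip hcint
    ((withDensity_absolutelyContinuous γ _).ae_le hae)
    ((withDensity_absolutelyContinuous γ _).ae_le hae) hσY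
  rw [hsum, hsnd₁, hmean hr hr0, hmean hs hs0] at hle
  rw [sub_le_iff_le_add]
  have := csInf_le hbdd ⟨_, hplan, rfl⟩
  unfold transportCost
  simp only at this
  linarith

end Congestion

namespace Congestion

/-! ### The lower bound on the density of the minimizer -/

lemma measurable_density (ν : Measure ℝ) : Measurable (density ν) :=
  (Measure.measurable_rnDeriv _ _).ennreal_toReal

lemma density_nonneg (ν : Measure ℝ) (y : ℝ) : 0 ≤ density ν y := ENNReal.toReal_nonneg

lemma withDensity_density (ν : Measure ℝ) [IsFiniteMeasure ν] (hν : ν ≪ volume) :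
    (volume.withDensity fun y => ENNReal.ofReal (density ν y)) = ν := by
  conv_rhs => rw [← Measure.withDensity_rnDeriv_eq ν volume hν]
  refine withDensity_congr_ae ?_
  filter_upwards [Measure.rnDeriv_lt_top ν volume] with y hy
  exact ENNReal.ofReal_toReal hy.ne

lemma density_withDensity {u : ℝ → ℝ} (hu : Measurable u) (h0 : ∀ y, 0 ≤ u y) :
    density (volume.withDensity fun y => ENNReal.ofReal (u y)) =ᵐ[volume] u := by
  filter_upwards [Measure.rnDeriv_withDensity volume hu.ennreal_ofReal] with y hy
  rw [density, hy, ENNReal.toReal_ofReal (h0 y)]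

lemma congestion_withDensity {f u : ℝ → ℝ} {Y : Set ℝ} (hu : Measurable u) (h0 : ∀ y, 0 ≤ u y)
    (hfu : IntegrableOn (fun y => f (u y)) Y) :
    congestion f Y (volume.withDensity fun y => ENNReal.ofReal (u y)) =
      ((∫ y in Y, f (u y) : ℝ) : EReal) := by
  have hae : (fun y => f (density (volume.withDensity fun y => ENNReal.ofReal (u y)) y))
      =ᵐ[volume.restrict Y] fun y => f (u y) :=
    ae_restrict_of_ae ((density_withDensity hu h0).mono fun y hy => by simp only [hy])
  rw [congestion, if_pos ⟨withDensity_absolutelyContinuous _ _, hfu.congr hae.symm⟩,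
    integral_congr_ae hae]

lemma isProbabilityMeasure_withDensity_ofReal {u : ℝ → ℝ} (hu : Integrable u) (h0 : ∀ y, 0 ≤ u y)
    (h1 : ∫ y, u y = 1) :
    IsProbabilityMeasure (volume.withDensity fun y => ENNReal.ofReal (u y)) := by
  constructor
  rw [withDensity_apply _ MeasurableSet.univ, Measure.restrict_univ,
    ← ofReal_integral_eq_lintegral_ofReal hu (ae_of_all _ h0), h1, ENNReal.ofReal_one]

/-- A minimizer has finite congestion: compare with the uniform measure. -/
lemma IsMinimizer.congestion_finite {m : ℕ} {b : ℝ} (hb : 0 < b) {c : E m → ℝ → ℝ}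
    {μ : Measure (E m)} {f : ℝ → ℝ} {ν : Measure ℝ} (hν : IsMinimizer (Set.Ioo 0 b) c μ f ν) :
    ν ≪ volume ∧ IntegrableOn (fun y => f (density ν y)) (Set.Ioo 0 b) := by
  set u : ℝ → ℝ := (Set.Ioo 0 b).indicator fun _ => b⁻¹ with hu
  have hum : Measurable u := measurable_const.indicator measurableSet_Ioo
  have hu0 : ∀ y, 0 ≤ u y := Set.indicator_nonneg fun _ _ => (inv_pos.2 hb).le
  have hui : Integrable u :=
    (integrable_indicator_iff measurableSet_Ioo).2 (integrableOn_const (by simp))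
  have hu1 : ∫ y, u y = 1 := by
    rw [hu, integral_indicator_const _ measurableSet_Ioo]
    simp [hb.le, hb.ne']
  have hfu : IntegrableOn (fun y => f (u y)) (Set.Ioo 0 b) := by
    have h1 : IntegrableOn (fun _ : ℝ => f b⁻¹) (Set.Ioo 0 b) := integrableOn_const (by simp)
    exact h1.congr_fun (fun y hy => by simp [hu, hy]) measurableSet_Ioo
  have hmem : (volume.withDensity fun y => ENNReal.ofReal (u y)) ∈
      probOn (closure (Set.Ioo 0 b)) := by
    refine ⟨isProbabilityMeasure_withDensity_ofReal hui hu0 hu1, ?_⟩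
    refine measure_mono_null (Set.compl_subset_compl.2 subset_closure) ?_
    rw [withDensity_apply _ measurableSet_Ioo.compl]
    refine (setLIntegral_congr_fun measurableSet_Ioo.compl fun y hy => ?_).trans lintegral_zero
    simp [hu, Set.indicator_of_notMem hy]
  have h := hν.2 _ hmem
  rw [congestion_withDensity hum hu0 hfu] at h
  by_contra hcon
  rw [congestion, if_neg hcon, EReal.coe_add_top, ← EReal.coe_add, top_le_iff] at h
  exact EReal.coe_ne_top _ h

/-- Gain in congestion from moving the density towards the interval `[l, h]`, when `f'(l) = p` and
`f'(h) = q`. -/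
lemma IsCongestionFunction.move_le {f : ℝ → ℝ} (hf : IsCongestionFunction f) {u p q θ θ' : ℝ}
    (hu : 0 ≤ u) (hpq : p ≤ q) (hθ : 0 < θ) (hθ1 : θ ≤ 1) (hθ' : 0 < θ') (hθ1' : θ' ≤ 1) :
    f (u - θ' * max (u - derivInv f q) 0 + θ * max (derivInv f p - u) 0) ≤
        f u + θ * max (derivInv f p - u) 0 * p - θ' * max (u - derivInv f q) 0 * q ∧
    (u < derivInv f p →
      f (u - θ' * max (u - derivInv f q) 0 + θ * max (derivInv f p - u) 0) <
        f u + θ * max (derivInv f p - u) 0 * p - θ' * max (u - derivInv f q) 0 * q) := by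
  have hle : derivInv f p ≤ derivInv f q := hf.strictMono_derivInv.monotone hpq
  have hpos := hf.derivInv_pos p
  have hposq := hf.derivInv_pos q
  rcases lt_or_ge u (derivInv f p) with h | h
  · have hlt : f (u - θ' * max (u - derivInv f q) 0 + θ * max (derivInv f p - u) 0) <
        f u + θ * max (derivInv f p - u) 0 * p - θ' * max (u - derivInv f q) 0 * q := by
      rw [max_eq_right (by linarith : u - derivInv f q ≤ 0),
        max_eq_left (by linarith : 0 ≤ derivInv f p - u)]
      set d := θ * (derivInv f p - u) with hd
      have hd0 : 0 < d := mul_pos hθ (by linarith)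
      have hd1 : d ≤ derivInv f p - u := mul_le_of_le_one_left (by linarith) hθ1
      -- The tangent is taken at the new value, which is positive even if `u = 0`; it does not
      -- exceed `derivInv f p`, so the slope there is at most `p`.
      have h1 := hf.tangent_lt (w := u + d) (t := u) (by linarith) hu (by linarith)
      have h2 : deriv f (u + d) ≤ p := by
        have := hf.strictMonoOn_deriv.monotoneOn (a := u + d) (b := derivInv f p)
          (by simp only [Set.mem_Ioi]; linarith) hpos (by linarith)
        rwa [hf.deriv_derivInv] at this
      have h3 := mul_le_mul_of_nonneg_left h2 hd0.le
      rw [mul_zero, sub_zero, zero_mul, sub_zero]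
      linarith
    exact ⟨hlt.le, fun _ => hlt⟩
  · refine ⟨?_, fun h' => absurd h' (not_lt.2 h)⟩
    rw [max_eq_right (by linarith : derivInv f p - u ≤ 0), mul_zero, add_zero, zero_mul, add_zero]
    rcases le_or_gt u (derivInv f q) with h' | h'
    · rw [max_eq_right (by linarith : u - derivInv f q ≤ 0)]
      simp
    · rw [max_eq_left (by linarith : 0 ≤ u - derivInv f q)]
      set d := θ' * (u - derivInv f q) with hd
      have hd0 : 0 < d := mul_pos hθ' (by linarith)
      have hd1 : d ≤ u - derivInv f q := mul_le_of_le_one_left (by linarith) hθ1'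
      have h1 := hf.tangent_le (w := u - d) (t := u) (by linarith) hu
      have h2 : q ≤ deriv f (u - d) := by
        have := hf.strictMonoOn_deriv.monotoneOn (a := derivInv f q) (b := u - d)
          hposq (by simp only [Set.mem_Ioi]; linarith) (by linarith)
        rwa [hf.deriv_derivInv] at this
      have h3 := mul_le_mul_of_nonneg_left h2 hd0.le
      linarith

/-- The density of the minimizer is bounded below by `lowerBound`. -/
theorem lowerBound_le_density {m : ℕ} {X : Set (E m)} (hXm : MeasurableSet X) {b M C : ℝ}
    (hb : 0 < b) {c : E m → ℝ → ℝ} (hM : 0 ≤ M)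
    (hlip : ∀ x ∈ X, ∀ y ∈ Set.Ioo 0 b, ∀ y' ∈ Set.Ioo 0 b, |c x y - c x y'| ≤ M * |y - y'|)
    (hcint : ∀ γ : Measure (E m × ℝ), IsFiniteMeasure γ → (∀ᵐ p ∂γ, p ∈ X ×ˢ Set.Ioo 0 b) →
      Integrable (fun p => c p.1 p.2) γ)
    (hC : ∀ x ∈ X, ∀ y ∈ Set.Ioo 0 b, |c x y| ≤ C)
    {μ : Measure (E m)} [IsProbabilityMeasure μ] (hμX : ∀ᵐ x ∂μ, x ∈ X)
    {f : ℝ → ℝ} (hf : IsCongestionFunction f) {ν : Measure ℝ}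
    (hν : IsMinimizer (Set.Ioo 0 b) c μ f ν) :
    ∀ᵐ y ∂(volume.restrict (Set.Ioo 0 b)), lowerBound f (Set.Ioo 0 b) M y ≤ density ν y := by
  obtain ⟨hac, hfi⟩ := hν.congestion_finite hb
  have hprob : IsProbabilityMeasure ν := hν.1.1
  set Y : Set ℝ := Set.Ioo 0 b with hY
  have hYm : MeasurableSet Y := measurableSet_Ioo
  -- The closure adds only the two endpoints, which are null as `ν` is absolutely continuous.
  have hνY : ν Yᶜ = 0 := by
    have hsub : Yᶜ ⊆ (closure Y)ᶜ ∪ {0, b} := by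
      intro y hy
      by_contra h
      simp only [Set.mem_union, not_or, Set.mem_compl_iff, not_not, hY, closure_Ioo hb.ne,
        Set.mem_insert_iff, Set.mem_singleton_iff] at h
      exact hy ⟨lt_of_le_of_ne h.1.1 (Ne.symm h.2.1), lt_of_le_of_ne h.1.2 h.2.2⟩
    refine measure_mono_null hsub (measure_union_null hν.1.2 (hac ?_))
    exact Set.Finite.measure_zero (by simp) _
  set u := density ν with hu
  have hum : Measurable u := measurable_density ν
  have hu0 : ∀ y, 0 ≤ u y := density_nonneg ν
  have hνu : (volume.withDensity fun y => ENNReal.ofReal (u y)) = ν := withDensity_density ν hac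
  have hui : Integrable u := Measure.integrable_toReal_rnDeriv
  have huY : ∫ y in Y, u y = 1 := by
    refine (Measure.setIntegral_toReal_rnDeriv hac Y).trans ?_
    rw [measureReal_def, (prob_compl_eq_zero_iff hYm).1 hνY, ENNReal.toReal_one]
  have huall : ∫ y, u y = 1 := (Measure.integral_toReal_rnDeriv hac).trans (by simp)
  set k := K f Y (fun t => -(M * t)) 1 with hk
  set l : ℝ → ℝ := fun y => derivInv f (k - M * y) with hl
  set h : ℝ → ℝ := fun y => derivInv f (k + M * y) with hh
  have hcd := hf.continuous_derivInv
  have hlc : Continuous l := by fun_prop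
  have hhc : Continuous h := by fun_prop
  have hIon : ∀ {g : ℝ → ℝ}, Continuous g → IntegrableOn g Y := fun hg =>
    (hg.integrableOn_Icc (a := 0) (b := b)).mono_set Set.Ioo_subset_Icc_self
  have hh1 : ∫ y in Y, h y = 1 := hf.integral_derivInv_K hb hM
  have hlh : ∀ y ∈ Y, l y ≤ h y := fun y hy => by
    refine hf.strictMono_derivInv.monotone ?_
    linarith [mul_nonneg hM hy.1.le]
  -- the admissible perturbations
  set s₀ : ℝ → ℝ := Y.indicator fun y => max (l y - u y) 0 with hs₀
  set r₀ : ℝ → ℝ := Y.indicator fun y => max (u y - h y) 0 with hr₀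
  have hs₀m : Measurable s₀ := ((hlc.measurable.sub hum).max measurable_const).indicator hYm
  have hr₀m : Measurable r₀ := ((hum.sub hhc.measurable).max measurable_const).indicator hYm
  have hs₀0 : ∀ y, 0 ≤ s₀ y := Set.indicator_nonneg fun _ _ => le_max_right _ _
  have hr₀0 : ∀ y, 0 ≤ r₀ y := Set.indicator_nonneg fun _ _ => le_max_right _ _
  have hs₀i : Integrable s₀ :=
    (integrable_indicator_iff hYm).2 ((hIon hlc).sub hui.integrableOn).pos_part
  have hr₀i : Integrable r₀ :=
    (integrable_indicator_iff hYm).2 (hui.integrableOn.sub (hIon hhc)).pos_part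
  have hr₀u : ∀ y, r₀ y ≤ u y := fun y => by
    by_cases hy : y ∈ Y
    · simp only [hr₀, Set.indicator_of_mem hy]
      exact max_le (by linarith [hf.derivInv_pos (k + M * y)]) (hu0 y)
    · simp only [hr₀, Set.indicator_of_notMem hy]
      exact hu0 y
  have hconcl : (s₀ =ᵐ[volume] 0) → ∀ᵐ y ∂(volume.restrict Y), lowerBound f Y M y ≤ u y := by
    intro hz
    refine (ae_restrict_iff' hYm).2 (hz.mono fun y hy hyY => ?_)
    simp only [hs₀, Set.indicator_of_mem hyY, Pi.zero_apply] at hy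
    have := max_eq_right_iff.1 hy
    simp only [lowerBound]
    linarith
  set A := ∫ y, s₀ y with hA
  set B := ∫ y, r₀ y with hB
  have hA0 : 0 ≤ A := integral_nonneg hs₀0
  have hB0 : 0 ≤ B := integral_nonneg hr₀0
  rcases hA0.eq_or_lt with hA' | hA'
  · exact hconcl ((integral_eq_zero_iff_of_nonneg hs₀0 hs₀i).1 hA'.symm)
  -- Without excess, `u ≤ h` a.e. on `Y`; both have mass one there, so `u = h ≥ l`.
  rcases hB0.eq_or_lt with hB' | hB'
  · have hz := (integral_eq_zero_iff_of_nonneg hr₀0 hr₀i).1 hB'.symm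
    have hle : 0 ≤ᵐ[volume.restrict Y] fun y => h y - u y :=
      (ae_restrict_iff' hYm).2 (hz.mono fun y hy hyY => by
        simp only [hr₀, Set.indicator_of_mem hyY, Pi.zero_apply] at hy
        have := max_eq_right_iff.1 hy
        simp only [Pi.zero_apply]
        linarith)
    have hzero : ∫ y in Y, (h y - u y) = 0 := by
      rw [integral_sub (hIon hhc) hui.integrableOn, hh1, huY, sub_self]
    have heq := (integral_eq_zero_iff_of_nonneg_ae hle ((hIon hhc).sub hui.integrableOn)).1 hzero
    filter_upwards [heq, ae_restrict_mem hYm] with y hy hyY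
    simp only [Pi.zero_apply] at hy
    have := hlh y hyY
    simp only [hl] at this
    simp only [lowerBound]
    linarith
  -- Deficit and excess are both scaled down to the common mass `t`, so the total mass is preserved
  -- and neither is overcorrected.
  set t := min A B with ht
  have ht0 : 0 < t := lt_min hA' hB'
  set θ := t / A with hθ
  set θ' := t / B with hθ'
  have hθ0 : 0 < θ := div_pos ht0 hA'
  have hθ0' : 0 < θ' := div_pos ht0 hB'
  have hθ1 : θ ≤ 1 := div_le_one_of_le₀ (min_le_left _ _) hA'.le
  have hθ1' : θ' ≤ 1 := div_le_one_of_le₀ (min_le_right _ _) hB'.le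
  set s : ℝ → ℝ := fun y => θ * s₀ y with hs
  set r : ℝ → ℝ := fun y => θ' * r₀ y with hr
  have hsm : Measurable s := hs₀m.const_mul θ
  have hrm : Measurable r := hr₀m.const_mul θ'
  have hs0 : ∀ y, 0 ≤ s y := fun y => mul_nonneg hθ0.le (hs₀0 y)
  have hr0 : ∀ y, 0 ≤ r y := fun y => mul_nonneg hθ0'.le (hr₀0 y)
  have hru : ∀ y, r y ≤ u y := fun y => (mul_le_of_le_one_left (hr₀0 y) hθ1').trans (hr₀u y)
  have hsi : Integrable s := hs₀i.const_mul θ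
  have hri : Integrable r := hr₀i.const_mul θ'
  have hsint : ∫ y, s y = t := by
    rw [hs, integral_const_mul, ← hA, hθ, div_mul_cancel₀ _ hA'.ne']
  have hrint : ∫ y, r y = t := by
    rw [hr, integral_const_mul, ← hB, hθ', div_mul_cancel₀ _ hB'.ne']
  have hsY : ∀ y ∉ Y, s y = 0 := fun y hy => by
    simp only [hs, hs₀, Set.indicator_of_notMem hy, mul_zero]
  have hrY : ∀ y ∉ Y, r y = 0 := fun y hy => by
    simp only [hr, hr₀, Set.indicator_of_notMem hy, mul_zero]
  set u' : ℝ → ℝ := fun y => u y - r y + s y with hu'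
  have hu'm : Measurable u' := (hum.sub hrm).add hsm
  have hu'0 : ∀ y, 0 ≤ u' y := fun y => by linarith [hru y, hs0 y]
  have hu'i : Integrable u' := (hui.sub hri).add hsi
  have hu'1 : ∫ y, u' y = 1 := by
    have h1 : ∫ y, u' y = (∫ y, (u y - r y)) + ∫ y, s y := integral_add (hui.sub hri) hsi
    rw [h1, integral_sub hui hri, huall, hsint, hrint]
    ring
  have hmove := transportCost_move_le hXm hM hlip hcint hC μ hμX hum hrm hsm hr0 hru hs0
    (by rw [hνu]; exact hprob) (by rw [hνu]; exact hνY) hsY hri hsi (hrint.trans hsint.symm)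
    (by rw [hrint]; exact ht0)
  rw [hνu] at hmove
  -- pointwise comparison of the congestion terms
  set G : ℝ → ℝ := fun y => f (u y) + s y * (k - M * y) - r y * (k + M * y) with hG
  have hpt : ∀ y ∈ Y, f (u' y) ≤ G y ∧ (s₀ y ≠ 0 → f (u' y) < G y) := fun y hy => by
    have := hf.move_le (u := u y) (p := k - M * y) (q := k + M * y) (hu0 y)
      (by linarith [mul_nonneg hM hy.1.le]) hθ0 hθ1 hθ0' hθ1'
    simp only [hG, hu', hs, hr, hs₀, hr₀, Set.indicator_of_mem hy]
    refine ⟨this.1, fun hne => this.2 ?_⟩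
    by_contra! hcon
    exact hne (max_eq_right (by simp only [hl]; linarith))
  have hyI : ∀ {g : ℝ → ℝ}, Measurable g → Integrable g → (∀ y ∉ Y, g y = 0) →
      Integrable fun y => g y * y := by
    intro g hgm hgi hgY
    refine (hgi.norm.mul_const b).mono' (hgm.mul measurable_id).aestronglyMeasurable
      (ae_of_all _ fun y => ?_)
    by_cases hy : y ∈ Y
    · rw [norm_mul, Real.norm_eq_abs y, abs_of_pos hy.1]
      exact mul_le_mul_of_nonneg_left hy.2.le (norm_nonneg _)
    · simp [hgY y hy]
  have hsy := hyI hsm hsi hsY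
  have hry := hyI hrm hri hrY
  have hset : ∀ {g : ℝ → ℝ}, (∀ y ∉ Y, g y = 0) → ∫ y in Y, g y = ∫ y, g y := fun hg =>
    setIntegral_eq_integral_of_forall_compl_eq_zero hg
  have hsI : Integrable fun y => s y * (k - M * y) := by
    refine ((hsi.mul_const k).sub (hsy.const_mul M)).congr (ae_of_all _ fun y => ?_)
    simp only [Pi.sub_apply]
    ring
  have hrI : Integrable fun y => r y * (k + M * y) := by
    refine ((hri.mul_const k).add (hry.const_mul M)).congr (ae_of_all _ fun y => ?_)
    simp only [Pi.add_apply]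
    ring
  have hsIv : ∫ y, s y * (k - M * y) = t * k - M * ∫ y, s y * y := by
    rw [← hsint, ← integral_mul_const, ← integral_const_mul,
      ← integral_sub (hsi.mul_const k) (hsy.const_mul M)]
    refine integral_congr_ae (ae_of_all _ fun y => ?_)
    simp only
    ring
  have hrIv : ∫ y, r y * (k + M * y) = t * k + M * ∫ y, r y * y := by
    rw [← hrint, ← integral_mul_const, ← integral_const_mul,
      ← integral_add (hri.mul_const k) (hry.const_mul M)]
    refine integral_congr_ae (ae_of_all _ fun y => ?_)
    simp only
    ring
  have hGi : IntegrableOn G Y := (hfi.add hsI.integrableOn).sub hrI.integrableOn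
  have hGint : ∫ y in Y, G y =
      (∫ y in Y, f (u y)) - M * (∫ y, r y * y) - M * ∫ y, s y * y := by
    have h1 : ∫ y in Y, G y =
        (∫ y in Y, (f (u y) + s y * (k - M * y))) - ∫ y in Y, r y * (k + M * y) :=
      integral_sub (hfi.add hsI.integrableOn) hrI.integrableOn
    rw [h1, integral_add hfi hsI.integrableOn,
      hset (g := fun y => s y * (k - M * y)) fun y hy => by simp [hsY y hy],
      hset (g := fun y => r y * (k + M * y)) fun y hy => by simp [hrY y hy], hsIv, hrIv]
    ring
  -- The new integrand lies between a tangent line of `f` at `1` and `G`, both integrable.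
  have hfu'i : IntegrableOn (fun y => f (u' y)) Y := by
    have hlow : IntegrableOn (fun y => f 1 + deriv f 1 * (u' y - 1)) Y := by
      have h1 : IntegrableOn (fun _ : ℝ => f 1 - deriv f 1) Y := integrableOn_const (by simp [hY])
      refine (h1.add (hu'i.integrableOn.const_mul (deriv f 1))).congr (ae_of_all _ fun y => ?_)
      simp only [Pi.add_apply]
      ring
    exact integrable_of_le_of_le (hf.measurable_comp hu'm hu'0).aestronglyMeasurable
      (ae_of_all _ fun y => hf.tangent_le one_pos (hu'0 y))
      ((ae_restrict_iff' hYm).2 (ae_of_all _ fun y hy => (hpt y hy).1)) hlow hGi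
  have hmem : (volume.withDensity fun y => ENNReal.ofReal (u' y)) ∈ probOn (closure Y) := by
    refine ⟨isProbabilityMeasure_withDensity_ofReal hu'i hu'0 hu'1, ?_⟩
    refine measure_mono_null (Set.compl_subset_compl.2 subset_closure) ?_
    rw [← hνu, withDensity_apply _ hYm.compl] at hνY
    rw [withDensity_apply _ hYm.compl, ← hνY]
    refine setLIntegral_congr_fun hYm.compl fun y hy => ?_
    simp [hu', hsY y hy, hrY y hy]
  have hmin := hν.2 _ hmem
  rw [congestion_withDensity hu'm hu'0 hfu'i, congestion, if_pos ⟨hac, hfi⟩] at hmin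
  have hmin' : transportCost c μ ν + ∫ y in Y, f (u y) ≤
      transportCost c μ (volume.withDensity fun y => ENNReal.ofReal (u' y)) +
        ∫ y in Y, f (u' y) := by
    exact_mod_cast hmin
  have hgap0 : 0 ≤ᵐ[volume.restrict Y] fun y => G y - f (u' y) :=
    (ae_restrict_iff' hYm).2 (ae_of_all _ fun y hy => sub_nonneg.2 (hpt y hy).1)
  -- Minimality makes this integral of a nonnegative function at most zero; hence the gap vanishes
  -- a.e., and with it the deficit `s₀`.
  have hgap : ∫ y in Y, (G y - f (u' y)) = 0 := by
    refine le_antisymm ?_ (integral_nonneg_of_ae hgap0)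
    rw [integral_sub hGi hfu'i, hGint]
    linarith
  have hgapae := (integral_eq_zero_iff_of_nonneg_ae hgap0 (hGi.sub hfu'i)).1 hgap
  refine hconcl ?_
  filter_upwards [(ae_restrict_iff' hYm).1 hgapae] with y hy
  by_contra hne
  by_cases hyY : y ∈ Y
  · have h1 := hy hyY
    have h2 := (hpt y hyY).2 hne
    simp only [Pi.zero_apply] at h1
    linarith
  · exact hne (by simp only [hs₀, Set.indicator_of_notMem hyY, Pi.zero_apply])

end Congestion

namespace Congestion

/-! ### Nestedness -/

/-- Makes the right endpoint the worst point of an interval, so that one value bounds the density on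
all of it. -/
lemma antitone_lowerBound {f : ℝ → ℝ} (hf : IsCongestionFunction f) (Y : Set ℝ) {M : ℝ}
    (hM : 0 ≤ M) : Antitone (lowerBound f Y M) := fun y y' h =>
  hf.strictMono_derivInv.monotone (by linarith [mul_le_mul_of_nonneg_left h hM])

/-- `k_max` is attained. -/
lemma superGE_subset_kMax {m : ℕ} {X : Set (E m)} {c : E m → ℝ → ℝ} {y₀ y₁ k₀ C : ℝ}
    (hC : ∀ x ∈ X, |dy c x y₁| ≤ C) (hne : (superGE X c y₀ k₀).Nonempty) :
    superGE X c y₀ k₀ ⊆ superGE X c y₁ (kMax X c y₀ y₁ k₀) := by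
  obtain ⟨x₀, hx₀⟩ := hne
  -- Each admissible `k` is at most `dy c x y₁`, because `x` lies in the smaller set; `-C` is
  -- admissible.
  refine fun x hx => ⟨hx.1, csSup_le ⟨-C, fun z hz => ⟨hz.1, ?_⟩⟩ fun k hk => (hk hx).2⟩
  exact (abs_le.1 (hC z hz.1)).1

/-- If the minimal mass difference is smaller than the mass of `(y₀, y₁]`, then the level sets at
`y₀` and `y₁` are strictly nested. -/
lemma superGE_subset_superGT {m : ℕ} {X : Set (E m)} {c : E m → ℝ → ℝ} {μ : Measure (E m)}
    [IsFiniteMeasure μ] {ν : Measure ℝ} [IsFiniteMeasure ν] {y₀ y₁ k₀ k₁ C : ℝ} (hy : y₀ < y₁)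
    (hC : ∀ x ∈ X, |dy c x y₁| ≤ C) (hmeas : MeasurableSet (superGE X c y₀ k₀))
    (h₀ : μ (superGE X c y₀ k₀) = ν (Set.Iic y₀)) (h₁ : μ (superGE X c y₁ k₁) = ν (Set.Iic y₁))
    (hlt : minMassDiff X c μ y₀ y₁ k₀ < ν.real (Set.Ioc y₀ y₁)) :
    superGE X c y₀ k₀ ⊆ superGT X c y₁ k₁ := by
  rcases (superGE X c y₀ k₀).eq_empty_or_nonempty with he | hne
  · rw [he]
    exact Set.empty_subset _
  have hsub := superGE_subset_kMax hC hne
  have hdiff : minMassDiff X c μ y₀ y₁ k₀ =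
      μ.real (superGE X c y₁ (kMax X c y₀ y₁ k₀)) - μ.real (superGE X c y₀ k₀) :=
    measureReal_sdiff hsub hmeas
  have hν : ν.real (Set.Iic y₁) = ν.real (Set.Iic y₀) + ν.real (Set.Ioc y₀ y₁) := by
    have hdisj : Disjoint (Set.Iic y₀) (Set.Ioc y₀ y₁) :=
      Set.disjoint_left.2 fun y h h' => not_lt.2 h h'.1
    rw [← measureReal_union hdisj measurableSet_Ioc, Set.Iic_union_Ioc_eq_Iic hy.le]
  have h₀' : μ.real (superGE X c y₀ k₀) = ν.real (Set.Iic y₀) := congrArg ENNReal.toReal h₀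
  have h₁' : μ.real (superGE X c y₁ k₁) = ν.real (Set.Iic y₁) := congrArg ENNReal.toReal h₁
  -- Otherwise the level set of mass `ν((-∞, y₁])` would lie in the one at `kMax`, whose mass is
  -- `ν((-∞, y₀])` plus the minimal difference, hence smaller.
  have hk : k₁ < kMax X c y₀ y₁ k₀ := by
    by_contra! hle
    have := measureReal_mono (μ := μ) (s₁ := superGE X c y₁ k₁)
      (s₂ := superGE X c y₁ (kMax X c y₀ y₁ k₀)) fun x hx => ⟨hx.1, hle.trans hx.2⟩
    linarith
  exact fun x hx => ⟨hx.1, hk.trans_le (hsub hx).2⟩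

end Congestion

theorem mainTheorem5 {m : ℕ} (hm : 1 < m)
    (X : Set (Congestion.E m)) (hXo : IsOpen X) (hXb : Bornology.IsBounded X)
    (ybar : ℝ) (hybar : 0 < ybar) (Y : Set ℝ) (hY : Y = Set.Ioo 0 ybar)
    (c : Congestion.E m → ℝ → ℝ)
    (hc : Congestion.IsC2OnClosure (X ×ˢ Y) (fun p : Congestion.E m × ℝ => c p.1 p.2))
    (htwist : Congestion.Twist X Y c) (hnondeg : Congestion.Nondegenerate X Y c)
    (μ : Measure (Congestion.E m)) [IsProbabilityMeasure μ] (hμX : μ Xᶜ = 0) (hμ : μ ≪ volume)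
    (f : ℝ → ℝ) (hf : Congestion.IsCongestionFunction f)
    (ν : Measure ℝ) (hν : Congestion.IsMinimizer Y c μ f ν) :
    (∃ k : ℝ → ℝ, Congestion.IsSplitting X Y c μ ν k) ∧
    ∀ k : ℝ → ℝ, Congestion.IsSplitting X Y c μ ν k →
      (∀ y₀ ∈ Y,
        (⨆ (y₁ ∈ Y) (_ : y₀ < y₁) (y ∈ Set.Icc y₀ y₁),
          ((Congestion.minMassDiff X c μ y₀ y₁ (k y₀) / (y₁ - y₀)
            - Congestion.lowerBound f Y (Congestion.lipConst X Y c) y : ℝ) : EReal)) < 0) →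
      Congestion.IsNested X Y c ν k := by
  subst hY
  have hprob : IsProbabilityMeasure ν := hν.1.1
  have hYo : IsOpen (Set.Ioo 0 ybar) := isOpen_Ioo
  have hYb : Bornology.IsBounded (Set.Ioo 0 ybar) := Metric.isBounded_Ioo 0 ybar
  refine ⟨Congestion.exists_isSplitting hXo hYo hc hXb hYb hnondeg μ hμX hμ ν, ?_⟩
  intro k hk hsup y₀ hy₀ y₁ hy₁ hlt _
  set M := Congestion.lipConst X (Set.Ioo 0 ybar) c with hMdef
  have hM : 0 ≤ M := Congestion.lipConst_nonneg
  obtain ⟨C, hC⟩ := hc.exists_bound (Congestion.isCompact_closure_prod hXb hYb)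
  obtain ⟨D, -, hD⟩ := Congestion.exists_dy_bound hXo hYo hc hXb hYb
  have hdens := Congestion.lowerBound_le_density hXo.measurableSet hybar (C := C) hM
    (fun x hx y hy y' hy' => Congestion.abs_cost_sub_le_lipConst hXo hYo hc hXb hYb
      (convex_Ioo 0 ybar) hx hy hy')
    (fun γ hγ hae => Congestion.integrable_of_continuousOn_of_bounded
      (hXo.prod hYo).measurableSet (hc.continuousOn.mono subset_closure)
      (fun p hp => hC p (subset_closure hp)) γ hae)
    (fun x hx y hy => hC (x, y) (subset_closure ⟨hx, hy⟩)) hμX hf hν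
  have hac := (hν.congestion_finite hybar).1
  have hbound : Congestion.minMassDiff X c μ y₀ y₁ (k y₀) / (y₁ - y₀) <
      Congestion.lowerBound f (Set.Ioo 0 ybar) M y₁ := by
    have h1 : ((Congestion.minMassDiff X c μ y₀ y₁ (k y₀) / (y₁ - y₀)
        - Congestion.lowerBound f (Set.Ioo 0 ybar) M y₁ : ℝ) : EReal) < 0 := by
      refine lt_of_le_of_lt ?_ (hsup y₀ hy₀)
      refine le_iSup₂_of_le y₁ hy₁ (le_iSup_of_le hlt ?_)
      -- Of the supremum over `y` only `y = y₁` is needed, where the lower bound is smallest.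
      exact le_iSup₂_of_le y₁ (Set.right_mem_Icc.2 hlt.le) le_rfl
    have h2 : Congestion.minMassDiff X c μ y₀ y₁ (k y₀) / (y₁ - y₀)
        - Congestion.lowerBound f (Set.Ioo 0 ybar) M y₁ < 0 := by exact_mod_cast h1
    linarith
  refine Congestion.superGE_subset_superGT hlt (fun x hx => hD x hx y₁ hy₁)
    (Congestion.measurableSet_superGE hXo hYo hc hy₀) (hk y₀ hy₀) (hk y₁ hy₁) ?_
  rw [div_lt_iff₀ (sub_pos.2 hlt)] at hbound
  refine hbound.trans_le ?_
  have hsub : Set.Ioc y₀ y₁ ⊆ Set.Ioo 0 ybar := fun y hy =>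
    ⟨hy₀.1.trans hy.1, hy.2.trans_lt hy₁.2⟩
  have hcint : ∫ _ in Set.Ioc y₀ y₁, Congestion.lowerBound f (Set.Ioo 0 ybar) M y₁ ≤
      ∫ y in Set.Ioc y₀ y₁, Congestion.density ν y := by
    refine integral_mono_ae (integrableOn_const (by simp))
      (Measure.integrable_toReal_rnDeriv (μ := ν)).integrableOn ?_
    filter_upwards [ae_restrict_of_ae_restrict_of_subset hsub hdens,
      ae_restrict_mem measurableSet_Ioc] with y hy hyI
    exact (Congestion.antitone_lowerBound hf _ hM hyI.2).trans hy
  rw [setIntegral_const] at hcint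
  have hmass : ∫ y in Set.Ioc y₀ y₁, Congestion.density ν y = ν.real (Set.Ioc y₀ y₁) :=
    Measure.setIntegral_toReal_rnDeriv hac _
  rw [hmass, Real.volume_real_Ioc_of_le hlt.le, smul_eq_mul] at hcint
  linarith
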